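/- Let $G$ be a finite connected simple graph with $N_0\ge 2$ vertices and $E_0$ edges, and let $n\ge 3$ be odd. Let $\tau_n(G)$ be the $n$-polygon graph of $G$: every edge $uv$ of $G$ is kept, and a new path of length $n$ from $u$ to $v$ (with $n-1$ new inner vertices) is added to it. For a graph $H$ without isolated vertices let $\mathcal L_H$ be its normalized Laplacian, with entries $\delta_{ij}-A_{ij}/\sqrt{d_id_j}$. For real $\mu$ define $a_{-1}(\mu)=0$, $a_0(\mu)=1$ and $a_k(\mu)=2(1-\mu)a_{k-1}(\mu)-a_{k-2}(\mu)$ for $k\ge 1$, and put $m=\frac{n-1}{2}$. Multiplicity $0$ means that the number is not an eigenvalue. Then the eigenvalues of $\mathcal L_{\tau_n(G)}$ and their multiplicities are as follows. (i) $0$ is an eigenvalue of $\mathcal L_{\tau_n(G)}$ of multiplicity $1$. If $G$ is bipartite, then $2$ is an eigenvalue of $\mathcal L_{\tau_n(G)}$ of multiplicity $1$. (ii) Every root $\mu$ of $a_m(\mu)=0$ is an eigenvalue of $\mathcal L_{\tau_n(G)}$ of multiplicity $N_0$. (iii) Every root $\mu$ of $a_m(\mu)+a_{m-1}(\mu)=0$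 has multiplicity $E_0-N_0+1$ for $\mathcal L_{\tau_n(G)}$. (iv) If $G$ is not bipartite, every root $\mu$ of $a_m(\mu)-a_{m-1}(\mu)=0$ has multiplicity $E_0-N_0$ for $\mathcal L_{\tau_n(G)}$. (v) If $G$ is bipartite, every root $\mu$ of $a_m(\mu)-a_{m-1}(\mu)=0$ has multiplicity $E_0-N_0+1$ for $\mathcal L_{\tau_n(G)}$. (vi) For every eigenvalue $\lambda\notin\{0,2\}$ of $\mathcal L_G$, the equation $$1-\frac{a_{m+1}(x)-a_{m-1}(x)}{a_m(x)-a_{m-2}(x)}=\lambda$$ has exactly $\frac{n+1}{2}$ distinct real roots (at which the denominator does not vanish), and each of them is an eigenvalue of $\mathcal L_{\tau_n(G)}$ whose multiplicity equals the multiplicity of $\lambda$ as an eigenvalue of $\mathcal L_G$. Moreover, every eigenvalue of $\mathcal L_{\tau_n(G)}$ is one of those listed in (i)–(vi); in particular, $2$ is an eigenvalue only if $G$ is bipartite. -/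

import Mathlib

/-- The sequence `a_{k-1}(μ)`, `k = 0, 1, 2, …`: values `0, 1`, then
`a_k = 2 (1 - μ) a_{k-1} - a_{k-2}`. -/
noncomputable def aShift (μ : ℝ) : ℕ → ℝ
  | 0 => 0
  | 1 => 1
  | k + 2 => 2 * (1 - μ) * aShift μ (k + 1) - aShift μ k

/-- `a_k(μ)` for `k ≥ -1` (only these indices are meaningful). -/
noncomputable def aSeq (k : ℤ) (μ : ℝ) : ℝ := aShift μ (k + 1).toNat

theorem aSeq_neg_one (μ : ℝ) : aSeq (-1) μ = 0 := by
  simp [aSeq, aShift]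

theorem aSeq_zero (μ : ℝ) : aSeq 0 μ = 1 := by
  simp [aSeq, aShift]

theorem aSeq_rec (k : ℤ) (hk : 1 ≤ k) (μ : ℝ) :
    aSeq k μ = 2 * (1 - μ) * aSeq (k - 1) μ - aSeq (k - 2) μ := by
  obtain ⟨j, hj⟩ := Int.eq_ofNat_of_zero_le (by omega : 0 ≤ k - 1)
  obtain rfl : k = (j : ℤ) + 1 := by omega
  have h1 : ((j : ℤ) + 1 + 1).toNat = j + 2 := by omega
  have h2 : ((j : ℤ) + 1 - 1 + 1).toNat = j + 1 := by omega
  have h3 : ((j : ℤ) + 1 - 2 + 1).toNat = j := by omega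
  simp only [aSeq, h1, h2, h3, aShift]

open Classical in
/-- The normalized Laplacian of a finite simple graph:
entry `(i, j)` is `δ_{ij} - A_{ij} / √(d_i d_j)`. -/
noncomputable def normalizedLaplacian {W : Type*} [Fintype W] (G : SimpleGraph W) :
    Matrix W W ℝ :=
  Matrix.of fun i j =>
    (if i = j then 1 else 0) -
      (if G.Adj i j then 1 else 0) / √((G.degree i : ℝ) * (G.degree j : ℝ))

/-- `μ` is an eigenvalue of the normalized Laplacian of `G`. -/
def IsNLEigenvalue {W : Type*} [Fintype W] (G : SimpleGraph W) (μ : ℝ) : Prop :=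
  Module.End.HasEigenvalue (normalizedLaplacian G).mulVecLin μ

/-- The multiplicity of `μ` as an eigenvalue of the (real symmetric) normalized Laplacian of `G`,
i.e. the dimension of the eigenspace (`0` when `μ` is not an eigenvalue). -/
noncomputable def nlMultiplicity {W : Type*} [Fintype W] (G : SimpleGraph W) (μ : ℝ) : ℕ :=
  Module.finrank ℝ (Module.End.eigenspace (normalizedLaplacian G).mulVecLin μ)

/-- Vertices of the `n`-polygon graph: the old vertices, and `n - 1` new vertices for every edge. -/
abbrev PolygonVertex {V : Type*} (G : SimpleGraph V) (n : ℕ) : Type _ :=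
  V ⊕ (G.edgeSet × Fin (n - 1))

/-- One of the two end vertices of an edge (an arbitrary choice of orientation). -/
noncomputable def edgeFst {V : Type*} {G : SimpleGraph V} (e : G.edgeSet) : V :=
  (Quot.out (e : Sym2 V)).1

/-- The other end vertex of an edge. -/
noncomputable def edgeSnd {V : Type*} {G : SimpleGraph V} (e : G.edgeSet) : V :=
  (Quot.out (e : Sym2 V)).2

theorem mk_edgeFst_edgeSnd {V : Type*} {G : SimpleGraph V} (e : G.edgeSet) :
    s(edgeFst e, edgeSnd e) = (e : Sym2 V) :=
  Quot.out_eq (e : Sym2 V)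

/-- Adjacency in the `n`-polygon graph (`n ≥ 2`): every old edge `e = uv` is kept, and a path
`u, (e, 0), (e, 1), …, (e, n - 2), v` of length `n` is added to it. -/
def polygonAdj {V : Type*} (G : SimpleGraph V) (n : ℕ) :
    PolygonVertex G n → PolygonVertex G n → Prop
  | .inl u, .inl v => G.Adj u v
  | .inl u, .inr (e, k) =>
      (u = edgeFst e ∧ (k : ℕ) = 0) ∨ (u = edgeSnd e ∧ (k : ℕ) + 2 = n)
  | .inr (e, k), .inl u =>
      (u = edgeFst e ∧ (k : ℕ) = 0) ∨ (u = edgeSnd e ∧ (k : ℕ) + 2 = n)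
  | .inr (e, k), .inr (f, l) =>
      e = f ∧ ((k : ℕ) + 1 = (l : ℕ) ∨ (l : ℕ) + 1 = (k : ℕ))

/-- The `n`-polygon graph `τ_n(G)` (`n ≥ 2`). -/
def polygonGraph {V : Type*} (G : SimpleGraph V) (n : ℕ) : SimpleGraph (PolygonVertex G n) where
  Adj := polygonAdj G n
  symm := ⟨by
    rintro (u | ⟨e, k⟩) (v | ⟨f, l⟩) h
    · exact SimpleGraph.Adj.symm (G := G) h
    · exact h
    · exact h
    · exact ⟨h.1.symm, h.2.symm⟩⟩
  loopless := ⟨by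
    rintro (u | ⟨e, k⟩) h
    · exact G.irrefl h
    · rcases h.2 with h | h <;> omega⟩

/-- With `n = 2 m + 1`, the real roots `x` of
`1 - (a_{m+1}(x) - a_{m-1}(x)) / (a_m(x) - a_{m-2}(x)) = t`; the denominator must not vanish. -/
def polygonRoots (m : ℕ) (t : ℝ) : Set ℝ :=
  {x | aSeq m x - aSeq ((m : ℤ) - 2) x ≠ 0 ∧
    1 - (aSeq ((m : ℤ) + 1) x - aSeq ((m : ℤ) - 1) x) /
      (aSeq m x - aSeq ((m : ℤ) - 2) x) = t}

/-! Rescaling by the square roots of the degrees turns the eigenvalue equation at `μ` into `A f = (1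
- μ) D f`. Inner vertices have degree 2, so along each attached path `f` obeys the recurrence of
`aShift`. Hence `f` is determined by its values `g` on the old vertices and the value `q e` at the
first inner vertex of each edge. What remains is one closing condition per edge and one equation per
old vertex (`polygonExtend_mem_iff`).

Put `c = 1 - μ`, `b = aShift μ (m + 1)`, `a = aShift μ m`. By `aShift_double`, `aShift μ n = b² -
a²`. If this is nonzero, the closing conditions express `q` through `g`, and with `aShift_cassini`
the vertex equations become `b (b - c a) A g = b (c b - a) D g` on `G`. For `b = 0` every `g` is
allowed; otherwise, if `b - c a ≠ 0`, `g` is an eigenfunction of `G` for the `t` with `1 - t = (c b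
- a) / (b - c a)`, and if `b - c a = 0` only `g = 0` is left.

If `b = -σ a` with `σ = ±1`, the closing conditions lose `q` and make `g` proportional along edges.
Testing the vertex equations against `g` then forces `g = 0`, and `q` ranges over the kernel of a
signed incidence matrix (`finrank_polygonSolutions_of_eq_zero`). Its dimension comes from
rank-nullity; for `σ = -1` it detects bipartiteness.

The quotient above is `T_{m+1}(c) / T_m(c)`, so the preimages of `t` are counted by the sign changes
of `cos ((m+1)θ) - (1-t) cos (mθ)` (`ncard_polygonRoots`). -/

/-! ### The recurrence: invariant, doubling, growth -/

theorem aShift_add_two (μ : ℝ) (k : ℕ) :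
    aShift μ (k + 2) = 2 * (1 - μ) * aShift μ (k + 1) - aShift μ k := by
  rw [aShift]

@[simp] theorem aShift_zero (μ : ℝ) : aShift μ 0 = 0 := by rw [aShift]

@[simp] theorem aShift_one (μ : ℝ) : aShift μ 1 = 1 := by rw [aShift]

/-- The recurrence preserves this quadratic form. It serves throughout as the normalization that
keeps two consecutive quantities from vanishing together. -/
theorem aShift_cassini (μ : ℝ) (k : ℕ) :
    aShift μ (k + 1) ^ 2 + aShift μ k ^ 2 - 2 * (1 - μ) * aShift μ (k + 1) * aShift μ k = 1 := by
  induction k with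
  | zero => simp
  | succ k ih => rw [aShift_add_two]; linear_combination ih

theorem aShift_double (μ : ℝ) (m : ℕ) :
    aShift μ (2 * m) = 2 * aShift μ m * (aShift μ (m + 1) - (1 - μ) * aShift μ m) ∧
    aShift μ (2 * m + 1) = aShift μ (m + 1) ^ 2 - aShift μ m ^ 2 := by
  induction m with
  | zero => simp
  | succ m ih =>
    obtain ⟨h1, h2⟩ := ih
    have h3 : aShift μ (2 * (m + 1)) =
        2 * aShift μ (m + 1) * ((1 - μ) * aShift μ (m + 1) - aShift μ m) := by
      rw [show 2 * (m + 1) = 2 * m + 2 by ring, aShift_add_two, h1, h2]; ring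
    refine ⟨?_, ?_⟩
    · rw [h3, aShift_add_two]; ring
    · rw [show 2 * (m + 1) + 1 = (2 * m + 1) + 2 by ring, aShift_add_two,
        show 2 * m + 1 + 1 = 2 * (m + 1) by ring, h3, h2, aShift_add_two]; ring

/-- The new term has absolute value at least twice the last one minus the one before. Consequently
none of the special equations in `a_m` and `a_{m-1}` has a root outside the open interval `(0, 2)`.
-/
theorem abs_aShift_lt_succ {μ : ℝ} (h : 1 ≤ |1 - μ|) (k : ℕ) :
    |aShift μ k| < |aShift μ (k + 1)| := by
  induction k with
  | zero => simp
  | succ k ih =>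
    rw [aShift_add_two]
    have h1 := abs_sub_abs_le_abs_sub (2 * (1 - μ) * aShift μ (k + 1)) (aShift μ k)
    have h2 : 2 * |aShift μ (k + 1)| ≤ |2 * (1 - μ) * aShift μ (k + 1)| := by
      rw [abs_mul, abs_mul, abs_two]
      nlinarith [abs_nonneg (aShift μ (k + 1))]
    linarith

/-! ### The rational equation and its Chebyshev form -/

theorem aSeq_natCast (m : ℕ) (μ : ℝ) : aSeq m μ = aShift μ (m + 1) := by
  simp only [aSeq]; congr 1

theorem aSeq_natCast_sub_one (m : ℕ) (μ : ℝ) : aSeq ((m : ℤ) - 1) μ = aShift μ m := by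
  simp only [aSeq]; congr 1; omega

theorem aSeq_sub_aSeq_sub_two {m : ℕ} (hm : 1 ≤ m) (μ : ℝ) :
    aSeq m μ - aSeq ((m : ℤ) - 2) μ = 2 * (aShift μ (m + 1) - (1 - μ) * aShift μ m) := by
  obtain ⟨k, rfl⟩ : ∃ k, m = k + 1 := ⟨m - 1, by omega⟩
  have h : aSeq (((k + 1 : ℕ) : ℤ) - 2) μ = aShift μ k := by
    simp only [aSeq]; congr 1; omega
  rw [aSeq_natCast, h, aShift_add_two]; ring

theorem aSeq_succ_sub_aSeq_pred (m : ℕ) (μ : ℝ) :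
    aSeq ((m : ℤ) + 1) μ - aSeq ((m : ℤ) - 1) μ =
      2 * ((1 - μ) * aShift μ (m + 1) - aShift μ m) := by
  have h : aSeq ((m : ℤ) + 1) μ = aShift μ (m + 2) := by
    simp only [aSeq]; congr 1
  rw [aSeq_natCast_sub_one, h, aShift_add_two]; ring

theorem mem_polygonRoots_iff {m : ℕ} (hm : 1 ≤ m) (t x : ℝ) :
    x ∈ polygonRoots m t ↔
      aShift x (m + 1) - (1 - x) * aShift x m ≠ 0 ∧
      (1 - x) * aShift x (m + 1) - aShift x m =
        (1 - t) * (aShift x (m + 1) - (1 - x) * aShift x m) := by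
  simp only [polygonRoots, Set.mem_ofPred_eq, aSeq_sub_aSeq_sub_two hm, aSeq_succ_sub_aSeq_pred]
  constructor
  · rintro ⟨h0, h⟩
    have h0' : aShift x (m + 1) - (1 - x) * aShift x m ≠ 0 := fun h => h0 (by rw [h, mul_zero])
    refine ⟨h0', ?_⟩
    field_simp at h
    linear_combination -h
  · rintro ⟨h0, h⟩
    refine ⟨mul_ne_zero two_ne_zero h0, ?_⟩
    rw [h]
    field_simp
    ring

open Polynomial in
theorem aShift_eq_eval_U (μ : ℝ) (k : ℕ) :
    aShift μ k = (Chebyshev.U ℝ ((k : ℤ) - 1)).eval (1 - μ) := by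
  induction k using Nat.twoStepInduction with
  | zero => simp
  | one => simp
  | more k h1 h2 =>
    rw [aShift_add_two, h1, h2, show ((k + 2 : ℕ) : ℤ) - 1 = ((k : ℤ) - 1) + 2 by push_cast; ring,
      Chebyshev.U_add_two]
    simp

open Polynomial in
theorem eval_T_eq_aShift (μ : ℝ) (k : ℕ) :
    (Chebyshev.T ℝ k).eval (1 - μ) = aShift μ (k + 1) - (1 - μ) * aShift μ k := by
  rw [aShift_eq_eval_U, aShift_eq_eval_U, Chebyshev.T_eq_U_sub_X_mul_U]
  simp

-- The condition on the denominator is automatic: with `b`, `a` the values of `aShift` at `m + 1`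
-- and `m`, Cassini reads `b * T_m - a * T_{m+1} = 1`, so `T_m` and `T_{m+1}` have no common zero.
open Polynomial in
theorem mem_polygonRoots_iff_eval_T {m : ℕ} (hm : 1 ≤ m) (t x : ℝ) :
    x ∈ polygonRoots m t ↔
      (Chebyshev.T ℝ ((m + 1 : ℕ) : ℤ) - C (1 - t) * Chebyshev.T ℝ m).eval (1 - x) = 0 := by
  rw [mem_polygonRoots_iff hm, eval_sub, eval_mul, eval_C, eval_T_eq_aShift, eval_T_eq_aShift,
    aShift_add_two, sub_eq_zero]
  have hc := aShift_cassini x m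
  constructor
  · rintro ⟨-, h⟩
    linear_combination h
  · intro h
    have h' : (1 - x) * aShift x (m + 1) - aShift x m =
        (1 - t) * (aShift x (m + 1) - (1 - x) * aShift x m) := by linear_combination h
    refine ⟨fun h0 => ?_, h'⟩
    rw [h0, mul_zero] at h'
    have : (1 : ℝ) = 0 := by
      linear_combination aShift x (m + 1) * h0 - aShift x m * h' - hc
    exact one_ne_zero this

-- At `θ = jπ/(m+1)` the first cosine is `(-1)^j` and outweighs the second term, so the sign
-- alternates between consecutive nodes.
open Real in
theorem exists_cos_sub_mul_cos_eq_zero {m : ℕ} {τ : ℝ} (hτ : |τ| < 1) (k : ℕ) :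
    ∃ θ ∈ Set.Ioo (k * π / (m + 1)) ((k + 1) * π / (m + 1)),
      cos ((m + 1) * θ) - τ * cos (m * θ) = 0 := by
  set F : ℝ → ℝ := fun θ => cos ((m + 1) * θ) - τ * cos (m * θ) with hF
  have hb (θ : ℝ) : |τ * cos (m * θ)| < 1 := by
    rw [abs_mul]
    nlinarith [abs_cos_le_one (m * θ), abs_nonneg (cos (m * θ)), abs_nonneg τ]
  have hm : (m : ℝ) + 1 ≠ 0 := by positivity
  have hv (j : ℕ) : 0 < (-1) ^ j * F (j * π / (m + 1)) := by
    have h1 : (m + 1 : ℝ) * (j * π / (m + 1)) = j * π := by field_simp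
    have h2 := abs_lt.mp (hb (j * π / (m + 1)))
    simp only [hF, h1, cos_nat_mul_pi]
    rcases neg_one_pow_eq_or ℝ j with h | h <;> rw [h] <;> linarith [h2.1, h2.2]
  have hc : Continuous F := by fun_prop
  have hle : (k : ℝ) * π / (m + 1) ≤ (k + 1) * π / (m + 1) := by
    gcongr; linarith
  have h1 := hv k
  have h2 := hv (k + 1)
  push_cast at h2
  rw [pow_succ] at h2
  rcases neg_one_pow_eq_or ℝ k with h | h <;> rw [h] at h1 h2
  · exact intermediate_value_Ioo' hle hc.continuousOn ⟨by linarith, by linarith⟩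
  · exact intermediate_value_Ioo hle hc.continuousOn ⟨by linarith, by linarith⟩

open Polynomial in
theorem natDegree_T_sub_C_mul_T (m : ℕ) (τ : ℝ) :
    (Chebyshev.T ℝ ((m + 1 : ℕ) : ℤ) - C τ * Chebyshev.T ℝ m).natDegree = m + 1 := by
  have h1 : (Chebyshev.T ℝ ((m + 1 : ℕ) : ℤ)).natDegree = m + 1 := by
    rw [Chebyshev.natDegree_T]; rfl
  have h2 : (C τ * Chebyshev.T ℝ m).natDegree ≤ m := by
    refine (natDegree_C_mul_le _ _).trans ?_
    rw [Chebyshev.natDegree_T]; rfl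
  rw [natDegree_sub_eq_left_of_natDegree_lt (by omega), h1]

-- The degree bounds the count from above. From below, each of the `m + 1` intervals in `[0, π]`
-- contributes a zero, and cosine is injective there.
open Polynomial in
theorem ncard_polygonRoots {m : ℕ} (hm : 1 ≤ m) {t : ℝ} (ht : |1 - t| < 1) :
    (polygonRoots m t).ncard = m + 1 := by
  set P : ℝ[X] := Chebyshev.T ℝ ((m + 1 : ℕ) : ℤ) - C (1 - t) * Chebyshev.T ℝ m with hP
  have hdeg : P.natDegree = m + 1 := natDegree_T_sub_C_mul_T m _
  have hP0 : P ≠ 0 := by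
    intro h; rw [h, natDegree_zero] at hdeg; omega
  have hset : polygonRoots m t = (fun c => 1 - c) '' (P.roots.toFinset : Set ℝ) := by
    ext x
    rw [mem_polygonRoots_iff_eval_T hm]
    simp only [Set.mem_image, Finset.mem_coe, Multiset.mem_toFinset, mem_roots hP0, IsRoot.def]
    constructor
    · intro h; exact ⟨1 - x, h, by ring⟩
    · rintro ⟨c, h, rfl⟩; rw [sub_sub_cancel]; exact h
  rw [hset, Set.ncard_image_of_injective _ sub_right_injective, Set.ncard_coe_finset]
  apply le_antisymm
  · exact (Multiset.toFinset_card_le _).trans ((card_roots' P).trans hdeg.le)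
  · choose θ hθ hθ0 using fun k : ℕ => exists_cos_sub_mul_cos_eq_zero (m := m) ht k
    have hmpos : (0 : ℝ) < m + 1 := by positivity
    have hmono : StrictMono θ := by
      refine strictMono_nat_of_lt_succ fun k => ?_
      have h1 := (hθ k).2
      have h2 := (hθ (k + 1)).1
      push_cast at h2
      exact h1.trans h2
    have hrange {k : ℕ} (hk : k ∈ Finset.range (m + 1)) : θ k ∈ Set.Icc 0 Real.pi := by
      have hk' : (k : ℝ) + 1 ≤ m + 1 := by exact_mod_cast Finset.mem_range.mp hk
      refine ⟨le_trans (by positivity) (hθ k).1.le, (hθ k).2.le.trans ?_⟩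
      rw [div_le_iff₀ hmpos]
      nlinarith [Real.pi_pos]
    rw [← Finset.card_range (m + 1)]
    refine Finset.card_le_card_of_injOn (fun k => Real.cos (θ k)) ?_ ?_
    · intro k hk
      have h : P.eval (Real.cos (θ k)) = 0 := by
        simp only [hP, eval_sub, eval_mul, eval_C, Chebyshev.T_real_cos]
        push_cast
        exact hθ0 k
      rw [Finset.mem_coe, Multiset.mem_toFinset, mem_roots hP0]
      exact h
    · intro k hk l hl h
      exact hmono.injective (Real.injOn_cos (hrange hk) (hrange hl) h)

/-! ### The equivalent problem `A f = c D f` -/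

open Classical in
/-- The sum of `f` over the neighbours of `u`. -/
noncomputable def nbrSum {W : Type*} [Fintype W] (G : SimpleGraph W) (f : W → ℝ) (u : W) : ℝ :=
  ∑ v, if G.Adj u v then f v else 0

/-- The solutions of `A f = c D f`, for the adjacency matrix `A` and the degree matrix `D`. -/
def walkEigenspace {W : Type*} [Fintype W] (G : SimpleGraph W) (c : ℝ) :
    Submodule ℝ (W → ℝ) where
  carrier := {f | ∀ u, nbrSum G f u = c * nbrSum G 1 u * f u}
  add_mem' := by
    intro f g hf hg u
    have : nbrSum G (f + g) u = nbrSum G f u + nbrSum G g u := by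
      simp only [nbrSum, ← Finset.sum_add_distrib, Pi.add_apply]
      exact Finset.sum_congr rfl fun v _ => by split_ifs <;> simp
    rw [this, hf u, hg u, Pi.add_apply, mul_add]
  zero_mem' := by intro u; simp [nbrSum]
  smul_mem' := by
    intro a f hf u
    have : nbrSum G (a • f) u = a * nbrSum G f u := by
      simp only [nbrSum, Finset.mul_sum, Pi.smul_apply, smul_eq_mul, mul_ite, mul_zero]
    rw [this, hf u, Pi.smul_apply, smul_eq_mul]; ring

theorem mem_walkEigenspace {W : Type*} [Fintype W] {G : SimpleGraph W} {c : ℝ} {f : W → ℝ} :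
    f ∈ walkEigenspace G c ↔ ∀ u, nbrSum G f u = c * nbrSum G 1 u * f u := Iff.rfl

open Classical in
theorem nbrSum_one {W : Type*} [Fintype W] (G : SimpleGraph W) (u : W) :
    nbrSum G 1 u = G.degree u := by
  simp [nbrSum, ← SimpleGraph.card_neighborFinset_eq_degree,
    SimpleGraph.neighborFinset_eq_filter]

theorem finrank_eq_of_map_eq {E F : Type*} [AddCommGroup E] [Module ℝ E] [AddCommGroup F]
    [Module ℝ F] (φ : E →ₗ[ℝ] F) (hφ : Function.Injective φ) {p : Submodule ℝ E}
    {q : Submodule ℝ F} (h : p.map φ = q) : Module.finrank ℝ q = Module.finrank ℝ p := by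
  subst h
  exact (LinearEquiv.finrank_eq (Submodule.equivMapOfInjective φ hφ p)).symm

theorem isNLEigenvalue_iff {W : Type*} [Fintype W] (G : SimpleGraph W) (μ : ℝ) :
    IsNLEigenvalue G μ ↔ nlMultiplicity G μ ≠ 0 := by
  rw [IsNLEigenvalue, nlMultiplicity, Module.End.hasEigenvalue_iff, ne_eq, ne_eq,
    Submodule.finrank_eq_zero]

/-- The map `f ↦ D^{1/2} f` carries one eigenspace onto the other, because the normalized Laplacian
is `1 - D^{-1/2} A D^{-1/2}`. -/
theorem nlMultiplicity_eq {W : Type*} [Fintype W] (G : SimpleGraph W)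
    (hd : ∀ u, 0 < nbrSum G 1 u) (μ : ℝ) :
    nlMultiplicity G μ = Module.finrank ℝ (walkEigenspace G (1 - μ)) := by
  classical
  have hs : ∀ u, √(nbrSum G 1 u) ≠ 0 := fun u => (Real.sqrt_pos.mpr (hd u)).ne'
  let e : (W → ℝ) ≃ₗ[ℝ] (W → ℝ) :=
    LinearEquiv.piCongrRight fun u => LinearEquiv.smulOfNeZero ℝ ℝ _ (hs u)
  have he (f : W → ℝ) (u : W) : e f u = √(nbrSum G 1 u) * f u := rfl
  refine finrank_eq_of_map_eq (e : (W → ℝ) →ₗ[ℝ] (W → ℝ)) e.injective ?_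
  have key (f : W → ℝ) : e f ∈ Module.End.eigenspace (normalizedLaplacian G).mulVecLin μ ↔
      f ∈ walkEigenspace G (1 - μ) := by
    rw [Module.End.mem_eigenspace_iff, mem_walkEigenspace, funext_iff]
    refine forall_congr' fun u => ?_
    have hL : (normalizedLaplacian G).mulVecLin (e f) u =
        √(nbrSum G 1 u) * f u - nbrSum G f u / √(nbrSum G 1 u) := by
      simp only [Matrix.mulVecLin_apply, Matrix.mulVec, dotProduct, normalizedLaplacian,
        Matrix.of_apply, sub_mul, Finset.sum_sub_distrib, he]
      congr 1
      · simp
      · rw [nbrSum, Finset.sum_div]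
        refine Finset.sum_congr rfl fun v _ => ?_
        have hv := hs v
        rw [← nbrSum_one, ← nbrSum_one, Real.sqrt_mul (hd u).le]
        have hu := hs u
        split_ifs
        · field_simp
        · simp
    rw [hL, Pi.smul_apply, he, smul_eq_mul]
    have hu := hs u
    have hsq := Real.mul_self_sqrt (hd u).le
    generalize √(nbrSum G 1 u) = r at *
    rw [← hsq]
    constructor
    · intro h
      field_simp at h
      linear_combination -h
    · intro h
      rw [h]
      field_simp
      ring
  ext x
  rw [Submodule.mem_map]
  constructor
  · rintro ⟨f, hf, rfl⟩; exact (key f).mpr hf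
  · intro hx
    refine ⟨e.symm x, (key _).mp (by rwa [e.apply_symm_apply]), e.apply_symm_apply x⟩

/-! ### Extreme eigenvalues and bipartiteness -/

/-- The functions that are multiplied by `σ` along every edge. -/
def edgeCompatible {W : Type*} (G : SimpleGraph W) (σ : ℝ) : Submodule ℝ (W → ℝ) where
  carrier := {f | ∀ u v, G.Adj u v → f u = σ * f v}
  add_mem' := by
    intro f g hf hg u v h
    rw [Pi.add_apply, Pi.add_apply, hf u v h, hg u v h, mul_add]
  zero_mem' := by intro u v _; simp
  smul_mem' := by
    intro a f hf u v h
    rw [Pi.smul_apply, Pi.smul_apply, hf u v h, smul_eq_mul, smul_eq_mul]; ring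

theorem mem_edgeCompatible {W : Type*} {G : SimpleGraph W} {σ : ℝ} {f : W → ℝ} :
    f ∈ edgeCompatible G σ ↔ ∀ u v, G.Adj u v → f u = σ * f v := Iff.rfl

theorem edgeCompatible_eq_zero {W : Type*} {G : SimpleGraph W} (hG : G.Connected) {σ : ℝ}
    {f : W → ℝ} (hf : f ∈ edgeCompatible G σ) {w : W} (hw : f w = 0) : f = 0 := by
  funext u
  obtain ⟨p⟩ := hG.preconnected u w
  induction p with
  | nil => exact hw
  | cons h p ih => rw [hf _ _ h, ih hw]; simp

/-- A zero at one vertex propagates along walks, so evaluation at a single vertex is injective. -/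
theorem finrank_edgeCompatible_le_one {W : Type*} [Fintype W] {G : SimpleGraph W}
    (hG : G.Connected) (σ : ℝ) : Module.finrank ℝ (edgeCompatible G σ) ≤ 1 := by
  obtain ⟨w⟩ := hG.nonempty
  rw [← Module.finrank_self ℝ]
  refine LinearMap.finrank_le_finrank_of_injective
    (f := (LinearMap.proj w : (W → ℝ) →ₗ[ℝ] ℝ).comp (edgeCompatible G σ).subtype) ?_
  rw [← LinearMap.ker_eq_bot, LinearMap.ker_eq_bot']
  intro f hf
  exact Subtype.ext (edgeCompatible_eq_zero hG f.2 hf)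

theorem finrank_edgeCompatible_eq_one {W : Type*} [Fintype W] {G : SimpleGraph W}
    (hG : G.Connected) {σ : ℝ} {f : W → ℝ} (hf : f ∈ edgeCompatible G σ) (hf0 : f ≠ 0) :
    Module.finrank ℝ (edgeCompatible G σ) = 1 := by
  refine le_antisymm (finrank_edgeCompatible_le_one hG σ) ?_
  rw [Nat.one_le_iff_ne_zero, ne_eq, Submodule.finrank_eq_zero]
  exact fun h => hf0 ((Submodule.mem_bot ℝ).mp (h ▸ hf))

theorem finrank_edgeCompatible_one {W : Type*} [Fintype W] {G : SimpleGraph W}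
    (hG : G.Connected) : Module.finrank ℝ (edgeCompatible G 1) = 1 := by
  have := hG.nonempty
  exact finrank_edgeCompatible_eq_one hG (f := 1) (fun _ _ _ => by simp) one_ne_zero

theorem finrank_edgeCompatible_neg_one {W : Type*} [Fintype W] {G : SimpleGraph W}
    (hG : G.Connected) (hb : G.IsBipartite) :
    Module.finrank ℝ (edgeCompatible G (-1)) = 1 := by
  obtain ⟨C⟩ := hb
  obtain ⟨w⟩ := hG.nonempty
  refine finrank_edgeCompatible_eq_one hG (f := fun v => if C v = 0 then 1 else -1) ?_ ?_
  · intro u v h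
    have := C.valid h
    by_cases hu : C u = 0 <;> by_cases hv : C v = 0
    · exact absurd (hu.trans hv.symm) this
    · simp [hu, hv]
    · simp [hu, hv]
    · exact absurd (by omega) this
  · intro h
    have := congrFun h w
    simp only [Pi.zero_apply] at this
    split_ifs at this <;> norm_num at this

/-- Such a function vanishes nowhere and changes sign along every edge; its sign is a 2-colouring.
-/
theorem isBipartite_of_mem_edgeCompatible {W : Type*} {G : SimpleGraph W}
    (hG : G.Connected) {f : W → ℝ} (hf : f ∈ edgeCompatible G (-1)) (hf0 : f ≠ 0) :
    G.IsBipartite := by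
  classical
  have hne (w : W) : f w ≠ 0 := fun h => hf0 (edgeCompatible_eq_zero hG hf h)
  refine ⟨SimpleGraph.Coloring.mk (fun v => if 0 < f v then 0 else 1) ?_⟩
  intro u v h
  have h1 := hf u v h
  rcases lt_or_gt_of_ne (hne v) with h2 | h2
  · have : 0 < f u := by linarith
    simp [this, h2.not_gt]
  · have : ¬ 0 < f u := by linarith
    simp [this, h2]

theorem finrank_edgeCompatible_neg_one_of_not {W : Type*} [Fintype W] {G : SimpleGraph W}
    (hG : G.Connected) (hb : ¬ G.IsBipartite) :
    Module.finrank ℝ (edgeCompatible G (-1)) = 0 := by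
  rw [Submodule.finrank_eq_zero, Submodule.eq_bot_iff]
  intro f hf
  by_contra h
  exact hb (isBipartite_of_mem_edgeCompatible hG hf h)

open Classical in
theorem sum_mul_nbrSum_one {W : Type*} [Fintype W] (G : SimpleGraph W) (g : W → ℝ) :
    ∑ u, g u * nbrSum G 1 u = ∑ u, ∑ v, if G.Adj u v then g u else 0 := by
  simp only [nbrSum, Finset.mul_sum, mul_ite, Pi.one_apply, mul_one, mul_zero]

-- This energy is nonnegative. For `A f = c D f` and `σ = ±1` it equals `2 (1 - σ c)` times the
-- weighted norm of `f`, which gives both `|c| ≤ 1` and the equality cases.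
open Classical in
theorem sum_sq_sub_mul {W : Type*} [Fintype W] (G : SimpleGraph W) (f : W → ℝ) (σ : ℝ) :
    (∑ u, ∑ v, if G.Adj u v then (f u - σ * f v) ^ 2 else 0) =
      (1 + σ ^ 2) * ∑ u, f u ^ 2 * nbrSum G 1 u - 2 * σ * ∑ u, f u * nbrSum G f u := by
  have h1 := sum_mul_nbrSum_one G fun u => f u ^ 2
  have h2 : ∑ u, f u ^ 2 * nbrSum G 1 u = ∑ u, ∑ v, if G.Adj u v then f v ^ 2 else 0 := by
    rw [h1, Finset.sum_comm]
    simp only [G.adj_comm]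
  have h3 : ∑ u, f u * nbrSum G f u = ∑ u, ∑ v, if G.Adj u v then f u * f v else 0 := by
    simp only [nbrSum, Finset.mul_sum, mul_ite, mul_zero]
  rw [add_mul, one_mul, h3]
  nth_rewrite 1 [h1]
  rw [h2]
  simp only [Finset.mul_sum, ← Finset.sum_add_distrib, ← Finset.sum_sub_distrib]
  refine Finset.sum_congr rfl fun u _ => Finset.sum_congr rfl fun v _ => ?_
  split_ifs <;> ring

theorem sum_mul_nbrSum_of_mem {W : Type*} [Fintype W] {G : SimpleGraph W} {c : ℝ} {f : W → ℝ}
    (hf : f ∈ walkEigenspace G c) :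
    ∑ u, f u * nbrSum G f u = c * ∑ u, f u ^ 2 * nbrSum G 1 u := by
  rw [Finset.mul_sum]
  exact Finset.sum_congr rfl fun u _ => by rw [hf u]; ring

theorem edgeCompatible_eq_walkEigenspace {W : Type*} [Fintype W] (G : SimpleGraph W) {σ : ℝ}
    (hσ : σ ^ 2 = 1) : walkEigenspace G σ = edgeCompatible G σ := by
  classical
  ext f
  constructor
  · intro hf u v huv
    have h := sum_sq_sub_mul G f σ
    rw [sum_mul_nbrSum_of_mem hf] at h
    have h0 : (∑ u, ∑ v, if G.Adj u v then (f u - σ * f v) ^ 2 else 0) = 0 := by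
      rw [h]; linear_combination (-∑ u, f u ^ 2 * nbrSum G 1 u) * hσ
    have hnn (u v : W) : 0 ≤ if G.Adj u v then (f u - σ * f v) ^ 2 else 0 := by
      split_ifs <;> positivity
    rw [Finset.sum_eq_zero_iff_of_nonneg fun u _ => Finset.sum_nonneg fun v _ => hnn u v] at h0
    have h1 := h0 u (Finset.mem_univ u)
    rw [Finset.sum_eq_zero_iff_of_nonneg fun v _ => hnn u v] at h1
    have h2 := h1 v (Finset.mem_univ v)
    rw [if_pos huv] at h2
    exact sub_eq_zero.mp (pow_eq_zero_iff two_ne_zero |>.mp h2)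
  · intro hf u
    simp only [nbrSum, Finset.mul_sum, Finset.sum_mul]
    refine Finset.sum_congr rfl fun v _ => ?_
    split_ifs with h
    · rw [Pi.one_apply, hf u v h]; linear_combination (-f v) * hσ
    · simp

theorem sum_sq_mul_pos {W : Type*} [Fintype W] {d : W → ℝ} (hd : ∀ u, 0 < d u) {f : W → ℝ}
    (hf : f ≠ 0) : 0 < ∑ u, f u ^ 2 * d u := by
  obtain ⟨u, hu⟩ := Function.ne_iff.mp hf
  refine Finset.sum_pos' (fun v _ => mul_nonneg (sq_nonneg _) (hd v).le) ⟨u, Finset.mem_univ u, ?_⟩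
  exact mul_pos (sq_pos_of_ne_zero hu) (hd u)

theorem abs_le_one_of_walkEigenspace_ne_bot {W : Type*} [Fintype W] {G : SimpleGraph W}
    (hd : ∀ u, 0 < nbrSum G 1 u) {c : ℝ} {f : W → ℝ} (hf : f ∈ walkEigenspace G c)
    (hf0 : f ≠ 0) : |c| ≤ 1 := by
  classical
  have hpos := sum_sq_mul_pos hd hf0
  have hnn (σ : ℝ) : 0 ≤ (∑ u, ∑ v, if G.Adj u v then (f u - σ * f v) ^ 2 else 0) :=
    Finset.sum_nonneg fun u _ => Finset.sum_nonneg fun v _ => by split_ifs <;> positivity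
  have h1 := hnn 1
  have h2 := hnn (-1)
  rw [sum_sq_sub_mul, sum_mul_nbrSum_of_mem hf] at h1 h2
  rw [abs_le]
  constructor <;> by_contra! h <;> nlinarith

/-! ### Neighbour sums in the polygon graph -/

section Polygon

variable {V : Type*} {G : SimpleGraph V} {n : ℕ}

open Classical in
theorem nbrSum_eq_sum_edgeSet [Fintype V] [Fintype G.edgeSet] (h : V → ℝ) (u : V) :
    nbrSum G h u = ∑ e : G.edgeSet,
      ((if u = edgeFst e then h (edgeSnd e) else 0) +
        (if u = edgeSnd e then h (edgeFst e) else 0)) := by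
  have h1 (e : G.edgeSet) : ((if u = edgeFst e then h (edgeSnd e) else 0) +
      (if u = edgeSnd e then h (edgeFst e) else 0)) =
      ∑ v, if (e : Sym2 V) = s(u, v) then h v else 0 := by
    have hne : edgeFst e ≠ edgeSnd e := by
      have := e.2
      rw [← mk_edgeFst_edgeSnd e, SimpleGraph.mem_edgeSet] at this
      exact this.ne
    rw [← mk_edgeFst_edgeSnd e]
    have h2 (v : V) : (if s(edgeFst e, edgeSnd e) = s(u, v) then h v else 0) =
        (if v = edgeSnd e then (if u = edgeFst e then h v else 0) else 0) +
        (if v = edgeFst e then (if u = edgeSnd e then h v else 0) else 0) := by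
      -- As `e` is not a loop, `u` is at most one of its ends, so no neighbour is counted twice.
      have hs := Sym2.eq_iff (x := edgeFst e) (y := edgeSnd e) (z := u) (w := v)
      by_cases a1 : u = edgeFst e <;> by_cases a2 : u = edgeSnd e <;>
        by_cases a3 : v = edgeFst e <;> by_cases a4 : v = edgeSnd e <;> grind
    simp only [h2, Finset.sum_add_distrib, Finset.sum_ite_eq', Finset.mem_univ, if_true]
  simp only [h1]
  rw [Finset.sum_comm, nbrSum]
  refine Finset.sum_congr rfl fun v _ => ?_
  split_ifs with huv
  · rw [Finset.sum_eq_single (⟨s(u, v), huv⟩ : G.edgeSet)]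
    · simp
    · intro e _ he
      exact if_neg fun h => he (Subtype.ext h)
    · intro h; exact absurd (Finset.mem_univ _) h
  · symm
    refine Finset.sum_eq_zero fun e _ => if_neg fun h => huv ?_
    have := e.2
    rwa [h, SimpleGraph.mem_edgeSet] at this

theorem adj_edgeFst_edgeSnd (e : G.edgeSet) : G.Adj (edgeFst e) (edgeSnd e) := by
  have := e.2
  rwa [← mk_edgeFst_edgeSnd e, SimpleGraph.mem_edgeSet] at this

/-- The values of `f` along the path of length `n` attached to the edge `e`. -/
noncomputable def pathValue (f : PolygonVertex G n → ℝ) (e : G.edgeSet) : ℕ → ℝ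
  | 0 => f (.inl (edgeFst e))
  | k + 1 => if h : k < n - 1 then f (.inr (e, ⟨k, h⟩)) else f (.inl (edgeSnd e))

theorem sum_fin_ite_eq {N : ℕ} (F : Fin N → ℝ) (j : ℕ) :
    (∑ l : Fin N, if j = (l : ℕ) then F l else 0) = if h : j < N then F ⟨j, h⟩ else 0 := by
  split_ifs with h
  · rw [Finset.sum_eq_single (⟨j, h⟩ : Fin N)]
    · simp
    · intro l _ hl
      exact if_neg fun h' => hl (Fin.ext h'.symm)
    · intro h'; exact absurd (Finset.mem_univ _) h'
  · refine Finset.sum_eq_zero fun l _ => if_neg fun h' => h ?_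
    rw [h']; exact l.2

open Classical in
theorem nbrSum_polygonGraph_inl [Fintype V] [Fintype G.edgeSet]
    (hn : 3 ≤ n) (f : PolygonVertex G n → ℝ) (u : V) :
    nbrSum (polygonGraph G n) f (.inl u) = nbrSum G (fun v => f (.inl v)) u +
      ∑ e : G.edgeSet, ((if u = edgeFst e then pathValue f e 1 else 0) +
        (if u = edgeSnd e then pathValue f e (n - 1) else 0)) := by
  rw [nbrSum, Fintype.sum_sum_type]
  congr 1
  rw [Fintype.sum_prod_type]
  refine Finset.sum_congr rfl fun e _ => ?_
  have h0 : 0 < n - 1 := by omega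
  have h1 : n - 2 < n - 1 := by omega
  have e1 : (if u = edgeFst e then pathValue f e 1 else 0) =
      ∑ l : Fin (n - 1), if 0 = (l : ℕ) then (if u = edgeFst e then f (.inr (e, l)) else 0)
        else 0 := by
    rw [sum_fin_ite_eq (fun l => if u = edgeFst e then f (.inr (e, l)) else 0), dif_pos h0,
      pathValue, dif_pos h0]
  have e2 : (if u = edgeSnd e then pathValue f e (n - 1) else 0) =
      ∑ l : Fin (n - 1), if n - 2 = (l : ℕ) then (if u = edgeSnd e then f (.inr (e, l)) else 0)
        else 0 := by
    have h2 : pathValue f e (n - 1) = f (.inr (e, ⟨n - 2, h1⟩)) := by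
      have : pathValue f e (n - 2 + 1) = f (.inr (e, ⟨n - 2, h1⟩)) := by rw [pathValue, dif_pos h1]
      rwa [show n - 2 + 1 = n - 1 by omega] at this
    rw [sum_fin_ite_eq (fun l => if u = edgeSnd e then f (.inr (e, l)) else 0), dif_pos h1, h2]
  rw [e1, e2, ← Finset.sum_add_distrib]
  refine Finset.sum_congr rfl fun l _ => ?_
  have hadj : (polygonGraph G n).Adj (.inl u) (.inr (e, l)) ↔
    (u = edgeFst e ∧ (l : ℕ) = 0) ∨ (u = edgeSnd e ∧ (l : ℕ) + 2 = n) := Iff.rfl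
  rw [if_congr hadj rfl rfl]
  have hl := l.2
  generalize f (.inr (e, l)) = y
  by_cases a1 : (l : ℕ) = 0
  · have a2 : ¬ n - 2 = (l : ℕ) := by omega
    have a3 : ¬ (l : ℕ) + 2 = n := by omega
    rw [if_pos a1.symm, if_neg a2]
    simp only [a1, and_true, add_zero]
    rw [a1] at a3
    simp [a3]
  · by_cases a2 : n - 2 = (l : ℕ)
    · have a3 : (l : ℕ) + 2 = n := by omega
      simp only [a1, a2, a3, Ne.symm a1, and_true, and_false, false_or, if_true, if_false, zero_add]
    · have a3 : ¬ (l : ℕ) + 2 = n := by omega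
      simp only [a1, a2, a3, Ne.symm a1, and_false, or_false, if_false, zero_add]

open Classical in
theorem nbrSum_polygonGraph_inr [Fintype V] [Fintype G.edgeSet]
    (f : PolygonVertex G n → ℝ) (e : G.edgeSet)
    (k : Fin (n - 1)) :
    nbrSum (polygonGraph G n) f (.inr (e, k)) = pathValue f e k + pathValue f e (k + 2) := by
  rw [nbrSum, Fintype.sum_sum_type]
  have hk := k.2
  have hadj (v : V) : (polygonGraph G n).Adj (.inr (e, k)) (.inl v) ↔
    (v = edgeFst e ∧ (k : ℕ) = 0) ∨ (v = edgeSnd e ∧ (k : ℕ) + 2 = n) := Iff.rfl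
  have hadj' (x : G.edgeSet × Fin (n - 1)) : (polygonGraph G n).Adj (.inr (e, k)) (.inr x) ↔
    e = x.1 ∧ ((k : ℕ) + 1 = (x.2 : ℕ) ∨ (x.2 : ℕ) + 1 = (k : ℕ)) := Iff.rfl
  have hne := (adj_edgeFst_edgeSnd e).ne
  have h1 : (∑ v, if (polygonGraph G n).Adj (.inr (e, k)) (.inl v) then f (.inl v) else 0) =
      (if (k : ℕ) = 0 then f (.inl (edgeFst e)) else 0) +
        (if (k : ℕ) + 2 = n then f (.inl (edgeSnd e)) else 0) := by
    have (v : V) : (if (polygonGraph G n).Adj (.inr (e, k)) (.inl v) then f (.inl v) else 0) =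
        (if v = edgeFst e then (if (k : ℕ) = 0 then f (.inl v) else 0) else 0) +
        (if v = edgeSnd e then (if (k : ℕ) + 2 = n then f (.inl v) else 0) else 0) := by
      rw [if_congr (hadj v) rfl rfl]
      grind
    simp only [this, Finset.sum_add_distrib, Finset.sum_ite_eq', Finset.mem_univ, if_true]
  have h2 : (∑ x, if (polygonGraph G n).Adj (.inr (e, k)) (.inr x) then f (.inr x) else 0) =
      (∑ l : Fin (n - 1), if (k : ℕ) + 1 = (l : ℕ) then f (.inr (e, l)) else 0) +
      (∑ l : Fin (n - 1), if (l : ℕ) + 1 = (k : ℕ) then f (.inr (e, l)) else 0) := by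
    rw [Fintype.sum_prod_type, Finset.sum_eq_single e]
    · rw [← Finset.sum_add_distrib]
      refine Finset.sum_congr rfl fun l _ => ?_
      rw [if_congr (hadj' (e, l)) rfl rfl]
      grind
    · intro e' _ he
      refine Finset.sum_eq_zero fun l _ => ?_
      rw [if_congr (hadj' (e', l)) rfl rfl]
      exact if_neg fun h => he h.1.symm
    · intro h; exact absurd (Finset.mem_univ _) h
  rw [h1, h2, sum_fin_ite_eq (fun l => f (.inr (e, l)))]
  have h3 : (if (k : ℕ) = 0 then f (.inl (edgeFst e)) else 0) +
      (∑ l : Fin (n - 1), if (l : ℕ) + 1 = (k : ℕ) then f (.inr (e, l)) else 0) =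
      pathValue f e k := by
    obtain ⟨k, hk⟩ := k
    cases k with
    | zero => simp [pathValue]
    | succ j =>
      have hj : j < n - 1 := by omega
      have (l : Fin (n - 1)) : ((l : ℕ) + 1 = j + 1) ↔ j = (l : ℕ) := by omega
      simp only [this, sum_fin_ite_eq (fun l => f (.inr (e, l))), pathValue, dif_pos hj]
      simp
  have h4 : (if (k : ℕ) + 2 = n then f (.inl (edgeSnd e)) else 0) +
      (if h : (k : ℕ) + 1 < n - 1 then f (.inr (e, ⟨(k : ℕ) + 1, h⟩)) else 0) =
      pathValue f e (k + 2) := by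
    rw [pathValue]
    by_cases h : (k : ℕ) + 1 < n - 1
    · rw [dif_pos h, dif_pos h, if_neg (by omega), zero_add]
    · rw [dif_neg h, dif_neg h, if_pos (by omega), add_zero]
  rw [← h3, ← h4]; ring

/-- Each edge at `u` brings one further neighbour, on its path. -/
theorem nbrSum_polygonGraph_one_inl [Fintype V] [Fintype G.edgeSet] (hn : 3 ≤ n) (u : V) :
    nbrSum (polygonGraph G n) 1 (.inl u) = 2 * nbrSum G 1 u := by
  have hp (e : G.edgeSet) (j : ℕ) : pathValue (n := n) 1 e j = 1 := by
    cases j with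
    | zero => rfl
    | succ j => simp [pathValue]
  rw [nbrSum_polygonGraph_inl hn]
  simp only [hp]
  have h := nbrSum_eq_sum_edgeSet (G := G) 1 u
  simp only [Pi.one_apply] at h
  rw [← h, two_mul]
  rfl

theorem nbrSum_polygonGraph_one_inr [Fintype V] [Fintype G.edgeSet]
    (e : G.edgeSet) (k : Fin (n - 1)) :
    nbrSum (polygonGraph G n) 1 (.inr (e, k)) = 2 := by
  have hp (e : G.edgeSet) (j : ℕ) : pathValue (n := n) 1 e j = 1 := by
    cases j with
    | zero => rfl
    | succ j => simp [pathValue]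
  rw [nbrSum_polygonGraph_inr, hp, hp]; norm_num

/-! ### Reduction to old vertices and first inner vertices -/

/-- The function that has the values `g` at the old vertices and continues along the path of every
edge `e` with the value `q e` at the first inner vertex, according to the recurrence. -/
noncomputable def polygonExtend (G : SimpleGraph V) (n : ℕ) (μ : ℝ) :
    (V → ℝ) × (G.edgeSet → ℝ) →ₗ[ℝ] (PolygonVertex G n → ℝ) where
  toFun p
    | .inl u => p.1 u
    | .inr (e, k) => aShift μ (k + 1) * p.2 e - aShift μ k * p.1 (edgeFst e)
  map_add' p q := by
    funext x
    rcases x with u | ⟨e, k⟩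
    · rfl
    · simp only [Prod.fst_add, Prod.snd_add, Pi.add_apply]; ring
  map_smul' a p := by
    funext x
    rcases x with u | ⟨e, k⟩
    · rfl
    · simp only [Prod.smul_fst, Prod.smul_snd, Pi.smul_apply, smul_eq_mul, RingHom.id_apply]; ring

theorem polygonExtend_injective (hn : 3 ≤ n) (μ : ℝ) :
    Function.Injective (polygonExtend G n μ) := by
  intro p q h
  have h1 : p.1 = q.1 := funext fun u => congrFun h (.inl u)
  refine Prod.ext h1 (funext fun e => ?_)
  have h2 := congrFun h (.inr (e, ⟨0, by omega⟩))
  simpa [polygonExtend] using h2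

/-- The conditions on `(g, q)` under which `polygonExtend` satisfies the eigenvalue equations. -/
def IsPolygonSolution [Fintype V] (G : SimpleGraph V) [Fintype G.edgeSet] (n : ℕ) (μ : ℝ)
    (p : (V → ℝ) × (G.edgeSet → ℝ)) : Prop :=
  (∀ e, aShift μ n * p.2 e - aShift μ (n - 1) * p.1 (edgeFst e) = p.1 (edgeSnd e)) ∧
  open Classical in
  ∀ u, nbrSum G p.1 u + ∑ e : G.edgeSet, ((if u = edgeFst e then p.2 e else 0) +
    (if u = edgeSnd e then aShift μ (n - 1) * p.2 e - aShift μ (n - 2) * p.1 (edgeFst e)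
      else 0)) = 2 * (1 - μ) * nbrSum G 1 u * p.1 u

theorem pathValue_polygonExtend (μ : ℝ) (p : (V → ℝ) × (G.edgeSet → ℝ)) (e : G.edgeSet) {k : ℕ}
    (hk : k < n - 1) : pathValue (polygonExtend G n μ p) e (k + 1) =
      aShift μ (k + 1) * p.2 e - aShift μ k * p.1 (edgeFst e) := by
  rw [pathValue, dif_pos hk]; rfl

theorem pathValue_last (hn : 3 ≤ n) (f : PolygonVertex G n → ℝ) (e : G.edgeSet) :
    pathValue f e n = f (.inl (edgeSnd e)) := by
  obtain ⟨k, rfl⟩ : ∃ k, n = k + 1 := ⟨n - 1, by omega⟩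
  rw [pathValue, dif_neg (by omega)]

/-- By construction the recurrence holds at every inner vertex but the last; there it says that the
continued value at position `n` is the value at the second end. -/
theorem polygonExtend_mem_iff [Fintype V] [Fintype G.edgeSet]
    (hn : 3 ≤ n) (μ : ℝ) (p : (V → ℝ) × (G.edgeSet → ℝ)) :
    polygonExtend G n μ p ∈ walkEigenspace (polygonGraph G n) (1 - μ) ↔
      IsPolygonSolution G n μ p := by
  have h1 (e : G.edgeSet) : pathValue (polygonExtend G n μ p) e 1 = p.2 e := by
    have := pathValue_polygonExtend (n := n) μ p e (k := 0) (by omega)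
    simpa using this
  have h2 (e : G.edgeSet) : pathValue (polygonExtend G n μ p) e (n - 1) =
      aShift μ (n - 1) * p.2 e - aShift μ (n - 2) * p.1 (edgeFst e) := by
    have := pathValue_polygonExtend (n := n) μ p e (k := n - 2) (by omega)
    rwa [show n - 2 + 1 = n - 1 by omega] at this
  rw [mem_walkEigenspace, Sum.forall, and_comm]
  refine and_congr ?_ ?_
  · constructor
    · intro h e
      obtain ⟨j, rfl⟩ : ∃ j, n = j + 3 := ⟨n - 3, by omega⟩
      have h3 := h (e, ⟨j + 1, by omega⟩)
      rw [nbrSum_polygonGraph_inr, nbrSum_polygonGraph_one_inr] at h3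
      have h4 : polygonExtend G (j + 3) μ p (.inr (e, ⟨j + 1, by omega⟩)) =
        aShift μ (j + 2) * p.2 e - aShift μ (j + 1) * p.1 (edgeFst e) := rfl
      have h5 : pathValue (polygonExtend G (j + 3) μ p) e (j + 3) = p.1 (edgeSnd e) :=
        pathValue_last hn _ e
      simp only [pathValue_polygonExtend μ p e (show j < j + 3 - 1 by omega)] at h3
      rw [h4, show j + 1 + 2 = j + 3 by omega, h5] at h3
      rw [show j + 3 - 1 = j + 2 by omega, aShift_add_two μ (j + 1),
        show j + 1 + 1 = j + 2 by omega]
      linear_combination (-1) * h3 - p.1 (edgeFst e) * aShift_add_two μ j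
    · rintro h ⟨e, ⟨k, hk⟩⟩
      rw [nbrSum_polygonGraph_inr, nbrSum_polygonGraph_one_inr]
      have h4 : polygonExtend G n μ p (.inr (e, ⟨k, hk⟩)) =
        aShift μ (k + 1) * p.2 e - aShift μ k * p.1 (edgeFst e) := rfl
      have h5 : pathValue (polygonExtend G n μ p) e (k + 2) =
          aShift μ (k + 2) * p.2 e - aShift μ (k + 1) * p.1 (edgeFst e) := by
        by_cases hk' : k + 1 < n - 1
        · exact pathValue_polygonExtend _ _ _ hk'
        · obtain rfl : n = k + 2 := by omega
          rw [pathValue_last hn]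
          exact (h e).symm
      rw [h4, h5]
      cases k with
      | zero =>
        have h6 : pathValue (polygonExtend G n μ p) e 0 = p.1 (edgeFst e) := rfl
        rw [h6, aShift_add_two]; simp only [zero_add, aShift_one, aShift_zero]; ring
      | succ k =>
        simp only [pathValue_polygonExtend μ p e (show k < n - 1 by omega)]
        rw [aShift_add_two μ (k + 1), aShift_add_two μ k]
        ring
  · refine forall_congr' fun u => ?_
    rw [nbrSum_polygonGraph_inl hn, nbrSum_polygonGraph_one_inl hn]
    simp only [h1, h2]
    have h5 (v : V) : polygonExtend G n μ p (.inl v) = p.1 v := rfl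
    simp only [h5]
    rw [show (1 - μ) * (2 * nbrSum G 1 u) * p.1 u = 2 * (1 - μ) * nbrSum G 1 u * p.1 u by ring]

theorem exists_polygonExtend_eq [Fintype V] [Fintype G.edgeSet] (μ : ℝ) {f : PolygonVertex G n → ℝ}
    (hf : f ∈ walkEigenspace (polygonGraph G n) (1 - μ)) :
    ∃ p, polygonExtend G n μ p = f := by
  refine ⟨(fun u => f (.inl u), fun e => pathValue f e 1), ?_⟩
  funext x
  rcases x with u | ⟨e, ⟨k, hk⟩⟩
  · rfl
  · have h (j : ℕ) (hj : j < n - 1) : pathValue f e (j + 1) =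
        aShift μ (j + 1) * pathValue f e 1 - aShift μ j * pathValue f e 0 := by
      induction j using Nat.twoStepInduction with
      | zero => simp
      | one =>
        have h1 := hf (.inr (e, ⟨0, by omega⟩))
        rw [nbrSum_polygonGraph_inr, nbrSum_polygonGraph_one_inr] at h1
        have h2 : pathValue f e 1 = f (.inr (e, ⟨0, by omega⟩)) := by
          rw [pathValue, dif_pos (by omega)]
        rw [← h2] at h1
        rw [aShift_add_two]
        simp only [zero_add, aShift_one, aShift_zero] at h1 ⊢
        linear_combination h1
      | more j ih1 ih2 =>
        have h1 := hf (.inr (e, ⟨j + 1, by omega⟩))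
        rw [nbrSum_polygonGraph_inr, nbrSum_polygonGraph_one_inr] at h1
        have h2 : pathValue f e (j + 1 + 1) = f (.inr (e, ⟨j + 1, by omega⟩)) := by
          rw [pathValue, dif_pos (by omega)]
        rw [← h2] at h1
        have ih1 := ih1 (by omega)
        have ih2 := ih2 (by omega)
        rw [ih2] at h1
        simp only [ih1] at h1
        rw [aShift_add_two μ (j + 1), aShift_add_two μ j]
        rw [aShift_add_two μ j] at h1
        simp only [show j + 1 + 2 = j + 2 + 1 by omega] at h1
        linear_combination h1
    have h1 : pathValue f e (k + 1) = f (.inr (e, ⟨k, hk⟩)) := by rw [pathValue, dif_pos hk]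
    rw [← h1, h k hk]
    rfl

/-- The solution space of `IsPolygonSolution`. -/
noncomputable def polygonSolutions [Fintype V] (G : SimpleGraph V) [Fintype G.edgeSet]
    (n : ℕ) (μ : ℝ) :
    Submodule ℝ ((V → ℝ) × (G.edgeSet → ℝ)) :=
  (walkEigenspace (polygonGraph G n) (1 - μ)).comap (polygonExtend G n μ)

theorem mem_polygonSolutions [Fintype V] [Fintype G.edgeSet]
    (hn : 3 ≤ n) {μ : ℝ} {p : (V → ℝ) × (G.edgeSet → ℝ)} :
    p ∈ polygonSolutions G n μ ↔ IsPolygonSolution G n μ p :=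
  polygonExtend_mem_iff hn μ p

theorem finrank_walkEigenspace_polygonGraph [Fintype V] [Fintype G.edgeSet] (hn : 3 ≤ n) (μ : ℝ) :
    Module.finrank ℝ (walkEigenspace (polygonGraph G n) (1 - μ)) =
      Module.finrank ℝ (polygonSolutions G n μ) := by
  refine finrank_eq_of_map_eq _ (polygonExtend_injective hn μ) ?_
  rw [polygonSolutions, Submodule.map_comap_eq, inf_eq_right]
  intro f hf
  exact exists_polygonExtend_eq μ hf

end Polygon

/-! ### Solving the reduced system -/

section Multiplicity

variable {V : Type*} {G : SimpleGraph V} {n : ℕ}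

/-- The values at the old vertices, completed by those at the first inner vertices that the edge
conditions of `IsPolygonSolution` prescribe if `aShift μ n ≠ 0`. -/
noncomputable def polygonLift (G : SimpleGraph V) (n : ℕ) (μ : ℝ) :
    (V → ℝ) →ₗ[ℝ] (V → ℝ) × (G.edgeSet → ℝ) where
  toFun g := (g, fun e => (g (edgeSnd e) + aShift μ (n - 1) * g (edgeFst e)) / aShift μ n)
  map_add' g h := by
    refine Prod.ext rfl (funext fun e => ?_)
    simp only [Pi.add_apply, Prod.mk_add_mk]; ring
  map_smul' a g := by
    refine Prod.ext rfl (funext fun e => ?_)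
    simp only [Pi.smul_apply, Prod.smul_mk, smul_eq_mul, RingHom.id_apply]; ring

theorem polygonLift_injective (μ : ℝ) : Function.Injective (polygonLift G n μ) :=
  fun _ _ h => congrArg Prod.fst h

/-- Multiplied by `aShift μ n`, the path neighbour of either end becomes the value at the opposite
end plus `aShift μ (n - 1)` times the value at this end. Summing over edges produces `A g + aShift μ
(n - 1) D g`. -/
theorem isPolygonSolution_polygonLift_iff [Fintype V] [Fintype G.edgeSet]
    (hn : 3 ≤ n) {μ : ℝ} (hs : aShift μ n ≠ 0)
    (g : V → ℝ) : IsPolygonSolution G n μ (polygonLift G n μ g) ↔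
      ∀ u, (aShift μ n + 1) * nbrSum G g u =
        (2 * (1 - μ) * aShift μ n - aShift μ (n - 1)) * nbrSum G 1 u * g u := by
  classical
  obtain ⟨k, rfl⟩ : ∃ k, n = k + 3 := ⟨n - 3, by omega⟩
  have hrec := aShift_add_two μ (k + 1)
  have hcas := aShift_cassini μ (k + 1)
  simp only [show k + 1 + 2 = k + 3 by omega, show k + 1 + 1 = k + 2 by omega] at hrec hcas
  have e1 : k + 3 - 1 = k + 2 := by omega
  have e2 : k + 3 - 2 = k + 1 := by omega
  simp only [e1]
  set q := (polygonLift G (k + 3) μ g).2 with hq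
  have hqe (e : G.edgeSet) :
      aShift μ (k + 3) * q e = g (edgeSnd e) + aShift μ (k + 2) * g (edgeFst e) := by
    rw [hq]
    exact mul_div_cancel₀ _ hs
  have hp1 : (polygonLift G (k + 3) μ g).1 = g := rfl
  rw [IsPolygonSolution, hp1, and_iff_right]
  · refine forall_congr' fun u => ?_
    rw [← hq, e1, e2]
    set S := ∑ e : G.edgeSet, ((if u = edgeFst e then q e else 0) +
      (if u = edgeSnd e then aShift μ (k + 2) * q e - aShift μ (k + 1) * g (edgeFst e)
        else 0)) with hS
    have hsum : aShift μ (k + 3) * S =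
        nbrSum G g u + aShift μ (k + 2) * nbrSum G 1 u * g u := by
      rw [nbrSum_eq_sum_edgeSet g, nbrSum_eq_sum_edgeSet 1, hS]
      simp only [Finset.mul_sum, Finset.sum_mul, ← Finset.sum_add_distrib]
      refine Finset.sum_congr rfl fun e _ => ?_
      -- Cassini restores the symmetry under reversing the path, which the choice of orientation
      -- hides.
      have hy : aShift μ (k + 3) *
          (aShift μ (k + 2) * q e - aShift μ (k + 1) * g (edgeFst e)) =
          g (edgeFst e) + aShift μ (k + 2) * g (edgeSnd e) := by
        rw [mul_sub, mul_left_comm, hqe, hrec]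
        linear_combination g (edgeFst e) * hcas
      rw [mul_add, mul_ite, mul_ite, mul_zero, hqe, hy]
      simp only [Pi.one_apply]
      split_ifs with h1 h2 h2
      · rw [← h1, ← h2]; ring
      · rw [← h1]; ring
      · rw [← h2]; ring
      · ring
    constructor
    · intro h
      linear_combination aShift μ (k + 3) * h - hsum
    · intro h
      refine mul_left_cancel₀ hs ?_
      linear_combination h + hsum
  · intro e
    rw [← hq, e1, hqe]; ring

theorem eq_polygonLift [Fintype V] [Fintype G.edgeSet]
    {μ : ℝ} (hs : aShift μ n ≠ 0) {p : (V → ℝ) × (G.edgeSet → ℝ)}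
    (hp : IsPolygonSolution G n μ p) : polygonLift G n μ p.1 = p := by
  refine Prod.ext rfl (funext fun e => ?_)
  have h := hp.1 e
  change (p.1 (edgeSnd e) + aShift μ (n - 1) * p.1 (edgeFst e)) / aShift μ n = p.2 e
  rw [div_eq_iff hs]
  linear_combination -h

theorem finrank_polygonSolutions_of_ne_zero [Fintype V] [Fintype G.edgeSet]
    (hn : 3 ≤ n) {μ : ℝ} (hs : aShift μ n ≠ 0)
    {K : Submodule ℝ (V → ℝ)}
    (hK : ∀ g, g ∈ K ↔ ∀ u, (aShift μ n + 1) * nbrSum G g u =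
        (2 * (1 - μ) * aShift μ n - aShift μ (n - 1)) * nbrSum G 1 u * g u) :
    Module.finrank ℝ (polygonSolutions G n μ) = Module.finrank ℝ K := by
  refine finrank_eq_of_map_eq _ (polygonLift_injective (n := n) μ) ?_
  ext p
  rw [Submodule.mem_map, mem_polygonSolutions hn]
  constructor
  · rintro ⟨g, hg, rfl⟩
    exact (isPolygonSolution_polygonLift_iff hn hs g).mpr ((hK g).mp hg)
  · intro hp
    have h := eq_polygonLift hs hp
    refine ⟨p.1, (hK _).mpr ((isPolygonSolution_polygonLift_iff hn hs _).mp ?_), h⟩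
    rwa [h]

/-! ### The degenerate case and signed incidence -/

open Classical in
/-- The signed incidence matrix: `1` at the first and `-σ` at the second end vertex. -/
noncomputable def signedIncMatrix (G : SimpleGraph V) (σ : ℝ) : Matrix V G.edgeSet ℝ :=
  Matrix.of fun u e => (if u = edgeFst e then 1 else 0) - σ * (if u = edgeSnd e then 1 else 0)

open Classical in
theorem signedIncMatrix_mulVec [Fintype G.edgeSet] (σ : ℝ) (q : G.edgeSet → ℝ) (u : V) :
    (signedIncMatrix G σ).mulVec q u =
      ∑ e : G.edgeSet, ((if u = edgeFst e then q e else 0) +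
        (if u = edgeSnd e then -σ * q e else 0)) := by
  simp only [Matrix.mulVec, dotProduct, signedIncMatrix, Matrix.of_apply]
  refine Finset.sum_congr rfl fun e _ => ?_
  split_ifs <;> ring

theorem ker_signedIncMatrix_transpose [Fintype V] {σ : ℝ} (hσ : σ ^ 2 = 1) :
    LinearMap.ker (signedIncMatrix G σ).transpose.mulVecLin = edgeCompatible G σ := by
  classical
  have key (g : V → ℝ) (e : G.edgeSet) : (signedIncMatrix G σ).transpose.mulVec g e =
      g (edgeFst e) - σ * g (edgeSnd e) := by
    simp only [Matrix.mulVec, dotProduct, signedIncMatrix, Matrix.of_apply, Matrix.transpose_apply,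
      sub_mul, Finset.sum_sub_distrib, ite_mul, mul_ite, one_mul, mul_one, mul_zero, zero_mul,
      Finset.sum_ite_eq', Finset.mem_univ, if_true]
  ext g
  rw [LinearMap.mem_ker, Matrix.mulVecLin_apply, funext_iff, mem_edgeCompatible]
  simp only [key, Pi.zero_apply, sub_eq_zero]
  constructor
  · intro h u v huv
    have h1 := h ⟨s(u, v), huv⟩
    have h2 := mk_edgeFst_edgeSnd (⟨s(u, v), huv⟩ : G.edgeSet)
    rcases Sym2.eq_iff.mp h2 with ⟨h3, h4⟩ | ⟨h3, h4⟩
    · rwa [h3, h4] at h1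
    · rw [h3, h4] at h1
      rw [h1]; linear_combination (-g u) * hσ
  · intro h e
    exact h _ _ (adj_edgeFst_edgeSnd e)

/-- Rank-nullity for the matrix and for its transpose, whose ranks agree. -/
theorem finrank_ker_signedIncMatrix [Fintype V] [Fintype G.edgeSet] {σ : ℝ} (hσ : σ ^ 2 = 1) :
    Module.finrank ℝ (LinearMap.ker (signedIncMatrix G σ).mulVecLin) + Fintype.card V =
      Fintype.card G.edgeSet + Module.finrank ℝ (edgeCompatible G σ) := by
  classical
  have h1 := LinearMap.finrank_range_add_finrank_ker (signedIncMatrix G σ).mulVecLin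
  have h2 := LinearMap.finrank_range_add_finrank_ker (signedIncMatrix G σ).transpose.mulVecLin
  rw [Module.finrank_fintype_fun_eq_card] at h1 h2
  rw [ker_signedIncMatrix_transpose hσ] at h2
  have h3 : Module.finrank ℝ (LinearMap.range (signedIncMatrix G σ).transpose.mulVecLin) =
      Module.finrank ℝ (LinearMap.range (signedIncMatrix G σ).mulVecLin) :=
    Matrix.rank_transpose (signedIncMatrix G σ)
  omega

open Classical in
theorem sum_mul_sum_edgeSet [Fintype V] [Fintype G.edgeSet] (g : V → ℝ) (x y : G.edgeSet → ℝ) :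
    ∑ u, g u * ∑ e : G.edgeSet, ((if u = edgeFst e then x e else 0) +
      (if u = edgeSnd e then y e else 0)) =
      ∑ e : G.edgeSet, (g (edgeFst e) * x e + g (edgeSnd e) * y e) := by
  simp only [Finset.mul_sum]
  rw [Finset.sum_comm]
  refine Finset.sum_congr rfl fun e _ => ?_
  simp only [mul_add, mul_ite, mul_zero, Finset.sum_add_distrib, Finset.sum_ite_eq',
    Finset.mem_univ, if_true]

/-- The closing conditions make `g` `σ`-compatible, so `A g = σ D g`. Pairing the vertex equations
with `g` cancels `q`, since `g (edgeFst e) = σ g (edgeSnd e)`, and leaves `(1 - μ - σ) ∑ g² d = 0`.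
-/
theorem fst_eq_zero_of_isPolygonSolution [Fintype V] [Fintype G.edgeSet]
    (hn : 3 ≤ n) (hd : ∀ u, 0 < nbrSum G 1 u) {μ σ : ℝ}
    (hs : aShift μ n = 0) (hs' : aShift μ (n - 1) = -σ) (hσ : σ ^ 2 = 1) (hμ : 1 - μ ≠ σ)
    {p : (V → ℝ) × (G.edgeSet → ℝ)} (hp : IsPolygonSolution G n μ p) : p.1 = 0 := by
  classical
  obtain ⟨g, q⟩ := p
  obtain ⟨he, hv⟩ := hp
  simp only [hs, hs'] at he hv
  have hs2 : aShift μ (n - 2) = -2 * (1 - μ) * σ := by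
    have := aShift_add_two μ (n - 2)
    rw [show n - 2 + 2 = n by omega, show n - 2 + 1 = n - 1 by omega, hs, hs'] at this
    linear_combination this
  rw [hs2] at hv
  have hgσ : g ∈ edgeCompatible G σ := by
    rw [mem_edgeCompatible]
    intro u v huv
    have h1 := he ⟨s(u, v), huv⟩
    have h2 := mk_edgeFst_edgeSnd (⟨s(u, v), huv⟩ : G.edgeSet)
    rcases Sym2.eq_iff.mp h2 with ⟨h3, h4⟩ | ⟨h3, h4⟩
    · rw [h3, h4] at h1
      linear_combination (-g u) * hσ + σ * h1
    · rw [h3, h4] at h1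
      linear_combination -h1
  have hw : ∀ u, nbrSum G g u = σ * nbrSum G 1 u * g u := by
    rw [← mem_walkEigenspace, edgeCompatible_eq_walkEigenspace G hσ]; exact hgσ
  by_contra hg
  have hpos := sum_sq_mul_pos hd hg
  have hg2 (e : G.edgeSet) : g (edgeSnd e) = σ * g (edgeFst e) := by
    linear_combination -he e
  have hS : ∑ u, g u ^ 2 * nbrSum G 1 u = 2 * ∑ e : G.edgeSet, g (edgeFst e) ^ 2 := by
    simp only [nbrSum_eq_sum_edgeSet 1]
    rw [sum_mul_sum_edgeSet (fun u => g u ^ 2), Finset.mul_sum]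
    refine Finset.sum_congr rfl fun e _ => ?_
    rw [hg2, Pi.one_apply, Pi.one_apply]
    linear_combination g (edgeFst e) ^ 2 * hσ
  have hsum : ∑ u, g u * ∑ e : G.edgeSet, ((if u = edgeFst e then q e else 0) +
      (if u = edgeSnd e then -σ * q e - -2 * (1 - μ) * σ * g (edgeFst e) else 0)) =
      2 * (1 - μ) * ∑ e : G.edgeSet, g (edgeFst e) ^ 2 := by
    rw [sum_mul_sum_edgeSet, Finset.mul_sum]
    refine Finset.sum_congr rfl fun e _ => ?_
    rw [hg2]
    linear_combination
      (2 * (1 - μ) * g (edgeFst e) ^ 2 - g (edgeFst e) * q e) * hσ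
  have htot : ∑ u, g u * (∑ e : G.edgeSet, ((if u = edgeFst e then q e else 0) +
      (if u = edgeSnd e then -σ * q e - -2 * (1 - μ) * σ * g (edgeFst e) else 0))) =
      (2 * (1 - μ) - σ) * ∑ u, g u ^ 2 * nbrSum G 1 u := by
    rw [Finset.mul_sum]
    refine Finset.sum_congr rfl fun u _ => ?_
    linear_combination g u * hv u - g u * hw u
  have : (1 - μ - σ) * ∑ u, g u ^ 2 * nbrSum G 1 u = 0 := by
    linear_combination hsum - htot - (1 - μ) * hS
  exact (mul_ne_zero (sub_ne_zero.mpr hμ) hpos.ne') this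

theorem finrank_polygonSolutions_of_eq_zero [Fintype V] [Fintype G.edgeSet]
    (hn : 3 ≤ n) (hd : ∀ u, 0 < nbrSum G 1 u) {μ σ : ℝ}
    (hs : aShift μ n = 0) (hs' : aShift μ (n - 1) = -σ) (hσ : σ ^ 2 = 1) (hμ : 1 - μ ≠ σ) :
    Module.finrank ℝ (polygonSolutions G n μ) + Fintype.card V =
      Fintype.card G.edgeSet + Module.finrank ℝ (edgeCompatible G σ) := by
  classical
  rw [← finrank_ker_signedIncMatrix hσ]
  congr 1
  refine finrank_eq_of_map_eq (LinearMap.inr ℝ (V → ℝ) (G.edgeSet → ℝ)) LinearMap.inr_injective ?_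
  have key (q : G.edgeSet → ℝ) : IsPolygonSolution G n μ (0, q) ↔
      q ∈ LinearMap.ker (signedIncMatrix G σ).mulVecLin := by
    rw [LinearMap.mem_ker, Matrix.mulVecLin_apply, funext_iff]
    simp only [signedIncMatrix_mulVec, IsPolygonSolution, hs, hs']
    simp [nbrSum]
  ext ⟨g, q⟩
  rw [Submodule.mem_map, mem_polygonSolutions hn]
  constructor
  · rintro ⟨q', hq', h⟩
    rw [← h]
    exact (key q').mpr hq'
  · intro hp
    obtain rfl : g = 0 := fst_eq_zero_of_isPolygonSolution hn hd hs hs' hσ hμ hp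
    exact ⟨q, (key q).mp hp, rfl⟩

end Multiplicity

/-! ### Multiplicities in terms of `a_m` and `a_{m-1}` -/

section Spectrum

variable {V : Type*} [Fintype V] {G : SimpleGraph V} {m : ℕ}

theorem nbrSum_one_pos [Nontrivial V] (hG : G.Connected) (u : V) : 0 < nbrSum G 1 u := by
  classical
  rw [nbrSum_one]
  exact_mod_cast hG.preconnected.degree_pos_of_nontrivial u

theorem nlMultiplicity_polygonGraph [Fintype G.edgeSet]
    {n : ℕ} (hn : 3 ≤ n) (hd : ∀ u, 0 < nbrSum G 1 u) (μ : ℝ) :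
    nlMultiplicity (polygonGraph G n) μ = Module.finrank ℝ (polygonSolutions G n μ) := by
  rw [nlMultiplicity_eq, finrank_walkEigenspace_polygonGraph hn]
  rintro (u | ⟨e, k⟩)
  · rw [nbrSum_polygonGraph_one_inl hn]; linarith [hd u]
  · rw [nbrSum_polygonGraph_one_inr]; norm_num

theorem nlMultiplicity_polygonGraph_of_ne_zero [Fintype G.edgeSet]
    (hm : 1 ≤ m) (hd : ∀ u, 0 < nbrSum G 1 u) {μ : ℝ}
    (hs : aShift μ (m + 1) ^ 2 - aShift μ m ^ 2 ≠ 0) {K : Submodule ℝ (V → ℝ)}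
    (hK : ∀ g, g ∈ K ↔ ∀ u, aShift μ (m + 1) *
        ((aShift μ (m + 1) - (1 - μ) * aShift μ m) * nbrSum G g u -
          ((1 - μ) * aShift μ (m + 1) - aShift μ m) * nbrSum G 1 u * g u) = 0) :
    nlMultiplicity (polygonGraph G (2 * m + 1)) μ = Module.finrank ℝ K := by
  have hn : 3 ≤ 2 * m + 1 := by omega
  obtain ⟨h1, h2⟩ := aShift_double μ m
  rw [nlMultiplicity_polygonGraph hn hd]
  refine finrank_polygonSolutions_of_ne_zero hn (by rwa [h2]) fun g => (hK g).trans ?_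
  refine forall_congr' fun u => ?_
  rw [Nat.add_sub_cancel, h1, h2]
  have hc := aShift_cassini μ m
  constructor
  · intro h
    -- By Cassini, `b² - a² + 1 = 2 b (b - c a)`; the factor `2 b` is common to both coefficients.
    linear_combination 2 * h - nbrSum G g u * hc
  · intro h
    linear_combination h / 2 + nbrSum G g u / 2 * hc

theorem nlMultiplicity_polygonGraph_of_aShift_eq_zero [Fintype G.edgeSet] (hm : 1 ≤ m)
    (hd : ∀ u, 0 < nbrSum G 1 u) {μ : ℝ} (hb : aShift μ (m + 1) = 0) :
    nlMultiplicity (polygonGraph G (2 * m + 1)) μ = Fintype.card V := by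
  have hc := aShift_cassini μ m
  rw [nlMultiplicity_polygonGraph_of_ne_zero hm hd (K := ⊤), finrank_top,
    Module.finrank_fintype_fun_eq_card]
  · intro h
    rw [hb] at h hc
    linarith
  · intro g
    simp [hb]

theorem nlMultiplicity_polygonGraph_eq [Fintype G.edgeSet]
    (hm : 1 ≤ m) (hd : ∀ u, 0 < nbrSum G 1 u) {μ t : ℝ}
    (hs : aShift μ (m + 1) ^ 2 - aShift μ m ^ 2 ≠ 0) (hb : aShift μ (m + 1) ≠ 0)
    (hμ : μ ∈ polygonRoots m t) :
    nlMultiplicity (polygonGraph G (2 * m + 1)) μ = nlMultiplicity G t := by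
  obtain ⟨h0, h⟩ := (mem_polygonRoots_iff hm t μ).mp hμ
  rw [nlMultiplicity_eq G hd]
  refine nlMultiplicity_polygonGraph_of_ne_zero hm hd hs fun g => ?_
  rw [mem_walkEigenspace]
  refine forall_congr' fun u => ?_
  rw [mul_eq_zero_iff_left hb, h, ← sub_eq_zero, ← mul_eq_zero_iff_left h0]
  ring_nf

/-- By Cassini the numerator cannot vanish as well, so the equation reduces to `D g = 0` with
positive degrees. -/
theorem nlMultiplicity_polygonGraph_of_den_eq_zero [Fintype G.edgeSet]
    (hm : 1 ≤ m) (hd : ∀ u, 0 < nbrSum G 1 u)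
    {μ : ℝ} (hs : aShift μ (m + 1) ^ 2 - aShift μ m ^ 2 ≠ 0) (hb : aShift μ (m + 1) ≠ 0)
    (h0 : aShift μ (m + 1) - (1 - μ) * aShift μ m = 0) :
    nlMultiplicity (polygonGraph G (2 * m + 1)) μ = 0 := by
  have hc := aShift_cassini μ m
  rw [nlMultiplicity_polygonGraph_of_ne_zero hm hd hs (K := ⊥), finrank_bot]
  have h1 : (1 - μ) * aShift μ (m + 1) - aShift μ m ≠ 0 := by
    intro h1
    have : (1 : ℝ) = 0 := by
      linear_combination aShift μ (m + 1) * h0 - aShift μ m * h1 - hc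
    exact one_ne_zero this
  intro g
  rw [Submodule.mem_bot, funext_iff]
  refine forall_congr' fun u => ?_
  rw [h0, zero_mul, zero_sub, mul_eq_zero_iff_left hb, neg_eq_zero, mul_assoc,
    mul_eq_zero_iff_left h1, mul_eq_zero_iff_left (hd u).ne', Pi.zero_apply]

theorem nlMultiplicity_zero [Nontrivial V] (hG : G.Connected) : nlMultiplicity G 0 = 1 := by
  rw [nlMultiplicity_eq G (nbrSum_one_pos hG), sub_zero,
    edgeCompatible_eq_walkEigenspace G (one_pow 2), finrank_edgeCompatible_one hG]

theorem nlMultiplicity_two [Nontrivial V] (hG : G.Connected) :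
    nlMultiplicity G 2 = Module.finrank ℝ (edgeCompatible G (-1)) := by
  rw [nlMultiplicity_eq G (nbrSum_one_pos hG), show (1 : ℝ) - 2 = -1 by norm_num,
    edgeCompatible_eq_walkEigenspace G (by norm_num)]

theorem aShift_ne_zero_of_one_le_abs {μ : ℝ} (h : 1 ≤ |1 - μ|) (m : ℕ) :
    aShift μ (m + 1) ≠ 0 ∧ aShift μ (m + 1) ^ 2 - aShift μ m ^ 2 ≠ 0 := by
  have h1 := abs_aShift_lt_succ h m
  refine ⟨fun h2 => ?_, ?_⟩
  · rw [h2, abs_zero] at h1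
    exact absurd h1 (abs_nonneg _).not_gt
  · exact (sub_pos.mpr (sq_lt_sq.mpr h1)).ne'

/-- The hypothesis means `μ = 0` or `μ = 2`; these are fixed by the correspondence, being roots for
`t = μ`. -/
theorem nlMultiplicity_polygonGraph_endpoint [Fintype G.edgeSet]
    (hm : 1 ≤ m) (hd : ∀ u, 0 < nbrSum G 1 u) {μ : ℝ}
    (hμ : (1 - μ) ^ 2 = 1) :
    nlMultiplicity (polygonGraph G (2 * m + 1)) μ = nlMultiplicity G μ := by
  have habs : 1 ≤ |1 - μ| := (one_le_sq_iff_one_le_abs _).mp hμ.ge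
  obtain ⟨hb, hs⟩ := aShift_ne_zero_of_one_le_abs habs m
  refine nlMultiplicity_polygonGraph_eq hm hd hs hb ((mem_polygonRoots_iff hm _ _).mpr ⟨?_, ?_⟩)
  · intro h
    apply hs
    linear_combination (aShift μ (m + 1) + (1 - μ) * aShift μ m) * h + aShift μ m ^ 2 * hμ
  · linear_combination aShift μ m * hμ

theorem nlMultiplicity_polygonGraph_add_card [Fintype G.edgeSet]
    (hm : 1 ≤ m) (hd : ∀ u, 0 < nbrSum G 1 u) {μ σ : ℝ}
    (hσ : σ ^ 2 = 1) (h : aShift μ (m + 1) = -σ * aShift μ m) :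
    nlMultiplicity (polygonGraph G (2 * m + 1)) μ + Fintype.card V =
      Fintype.card G.edgeSet + Module.finrank ℝ (edgeCompatible G σ) := by
  have hn : 3 ≤ 2 * m + 1 := by omega
  obtain ⟨h1, h2⟩ := aShift_double μ m
  have hc := aShift_cassini μ m
  rw [h] at h1 h2 hc
  have hs : aShift μ (2 * m + 1) = 0 := by
    rw [h2]; linear_combination aShift μ m ^ 2 * hσ
  rw [nlMultiplicity_polygonGraph hn hd]
  refine finrank_polygonSolutions_of_eq_zero hn hd hs ?_ hσ ?_
  · rw [Nat.add_sub_cancel, h1]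
    -- Cassini becomes `2 a² (1 + c σ) = 1`, and the left side is `-2 a² (σ + c)`.
    linear_combination (-σ) * hc + (aShift μ m ^ 2 * σ + 2 * (1 - μ) * aShift μ m ^ 2) * hσ
  · intro hμ
    refine (aShift_ne_zero_of_one_le_abs (μ := μ) ?_ m).2 ?_
    · rw [hμ]; exact (one_le_sq_iff_one_le_abs _).mp hσ.ge
    · rw [h]; linear_combination aShift μ m ^ 2 * hσ

theorem abs_one_sub_lt_one_of_isNLEigenvalue (hd : ∀ u, 0 < nbrSum G 1 u) {t : ℝ}
    (ht : IsNLEigenvalue G t) (h0 : t ≠ 0) (h2 : t ≠ 2) : |1 - t| < 1 := by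
  rw [isNLEigenvalue_iff, nlMultiplicity_eq G hd, ne_eq, Submodule.finrank_eq_zero,
    Submodule.eq_bot_iff] at ht
  push Not at ht
  obtain ⟨f, hf, hf0⟩ := ht
  refine lt_of_le_of_ne (abs_le_one_of_walkEigenspace_ne_bot hd hf hf0) fun h => ?_
  rcases eq_or_eq_neg_of_abs_eq h with h | h
  · exact h0 (by linarith)
  · exact h2 (by linarith)

/-- If `b = 0`, the equation gives `(1 - t)(1 - μ) = 1`, hence `|1 - μ| ≥ 1`, which growth excludes.
The cases `b = a` and `b = -a` would force `t = 2` and `t = 0`. -/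
theorem aShift_ne_zero_of_mem_polygonRoots (hm : 1 ≤ m) {t μ : ℝ} (ht : |1 - t| < 1)
    (hμ : μ ∈ polygonRoots m t) :
    aShift μ (m + 1) ≠ 0 ∧ aShift μ (m + 1) ^ 2 - aShift μ m ^ 2 ≠ 0 := by
  obtain ⟨h0, h⟩ := (mem_polygonRoots_iff hm t μ).mp hμ
  have hc := aShift_cassini μ m
  have ht' := abs_lt.mp ht
  refine ⟨fun hb => ?_, fun hs => ?_⟩
  · have h1 : (1 - t) * (1 - μ) = 1 := by
      rw [hb] at h hc
      linear_combination aShift μ m * h + (1 - (1 - t) * (1 - μ)) * hc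
    refine (aShift_ne_zero_of_one_le_abs (μ := μ) ?_ m).1 hb
    have h2 : |1 - t| * |1 - μ| = 1 := by rw [← abs_mul, h1, abs_one]
    nlinarith [abs_nonneg (1 - μ)]
  · rcases sq_eq_sq_iff_eq_or_eq_neg.mp (sub_eq_zero.mp hs) with h1 | h1
    · have : (2 - t) * (aShift μ (m + 1) - (1 - μ) * aShift μ m) = 0 := by
        rw [h1] at h ⊢; linear_combination -h
      rcases mul_eq_zero.mp this with h2 | h2
      · linarith [ht'.1]
      · exact h0 h2
    · have : t * (aShift μ (m + 1) - (1 - μ) * aShift μ m) = 0 := by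
        rw [h1] at h ⊢; linear_combination h
      rcases mul_eq_zero.mp this with h2 | h2
      · linarith [ht'.2]
      · exact h0 h2

theorem eq_of_isNLEigenvalue_polygonGraph [Fintype G.edgeSet]
    [Nontrivial V] (hG : G.Connected) (hm : 1 ≤ m) {μ : ℝ}
    (hμ : IsNLEigenvalue (polygonGraph G (2 * m + 1)) μ)
    (hb : aShift μ (m + 1) ≠ 0) (h1 : aShift μ (m + 1) + aShift μ m ≠ 0)
    (h2 : aShift μ (m + 1) - aShift μ m ≠ 0) :
    μ = 0 ∨ (G.IsBipartite ∧ μ = 2) ∨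
      ∃ t : ℝ, IsNLEigenvalue G t ∧ t ≠ 0 ∧ t ≠ 2 ∧ μ ∈ polygonRoots m t := by
  have hd := nbrSum_one_pos hG
  have hs : aShift μ (m + 1) ^ 2 - aShift μ m ^ 2 ≠ 0 := by
    rw [sq_sub_sq]; exact mul_ne_zero h1 h2
  rw [isNLEigenvalue_iff] at hμ
  by_cases h0 : aShift μ (m + 1) - (1 - μ) * aShift μ m = 0
  · exact absurd (nlMultiplicity_polygonGraph_of_den_eq_zero hm hd hs hb h0) hμ
  -- This is the only `t` that can correspond to `μ`. Below, `t = 0` gives `μ (b + a) = 0` and `t =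
  -- 2` gives `(2 - μ)(b - a) = 0`.
  obtain ⟨t, ht⟩ : ∃ t : ℝ, (1 - μ) * aShift μ (m + 1) - aShift μ m =
      (1 - t) * (aShift μ (m + 1) - (1 - μ) * aShift μ m) :=
    ⟨1 - ((1 - μ) * aShift μ (m + 1) - aShift μ m) /
      (aShift μ (m + 1) - (1 - μ) * aShift μ m), by rw [sub_sub_cancel, div_mul_cancel₀ _ h0]⟩
  have hmem : μ ∈ polygonRoots m t := (mem_polygonRoots_iff hm t μ).mpr ⟨h0, ht⟩
  rw [nlMultiplicity_polygonGraph_eq hm hd hs hb hmem] at hμ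
  by_cases ht0 : t = 0
  · left
    have : μ * (aShift μ (m + 1) + aShift μ m) = 0 := by
      rw [ht0] at ht; linear_combination -ht
    exact (mul_eq_zero.mp this).resolve_right h1
  by_cases ht2 : t = 2
  · right; left
    have : (2 - μ) * (aShift μ (m + 1) - aShift μ m) = 0 := by
      rw [ht2] at ht; linear_combination ht
    refine ⟨?_, by linarith [(mul_eq_zero.mp this).resolve_right h2]⟩
    by_contra hbip
    rw [ht2, nlMultiplicity_two hG] at hμ
    exact hμ (finrank_edgeCompatible_neg_one_of_not hG hbip)
  · exact Or.inr (Or.inr ⟨t, (isNLEigenvalue_iff G t).mpr hμ, ht0, ht2, hmem⟩)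

end Spectrum

/-! ### The full spectrum -/

theorem theorem1 {V : Type*} [Fintype V] [DecidableEq V] [Nontrivial V]
    (G : SimpleGraph V) [DecidableRel G.Adj] (hG : G.Connected)
    (n m : ℕ) (hn : 3 ≤ n) (hm : n = 2 * m + 1) :
    -- (i)
    (IsNLEigenvalue (polygonGraph G n) 0 ∧ nlMultiplicity (polygonGraph G n) 0 = 1) ∧
    (G.IsBipartite →
      IsNLEigenvalue (polygonGraph G n) 2 ∧ nlMultiplicity (polygonGraph G n) 2 = 1) ∧
    -- (ii)
    (∀ μ : ℝ, aSeq m μ = 0 →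
      IsNLEigenvalue (polygonGraph G n) μ ∧
        nlMultiplicity (polygonGraph G n) μ = Fintype.card V) ∧
    -- (iii)
    (∀ μ : ℝ, aSeq m μ + aSeq ((m : ℤ) - 1) μ = 0 →
      (nlMultiplicity (polygonGraph G n) μ : ℤ) =
        (G.edgeFinset.card : ℤ) - (Fintype.card V : ℤ) + 1) ∧
    -- (iv)
    (¬ G.IsBipartite → ∀ μ : ℝ, aSeq m μ - aSeq ((m : ℤ) - 1) μ = 0 →
      (nlMultiplicity (polygonGraph G n) μ : ℤ) =
        (G.edgeFinset.card : ℤ) - (Fintype.card V : ℤ)) ∧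
    -- (v)
    (G.IsBipartite → ∀ μ : ℝ, aSeq m μ - aSeq ((m : ℤ) - 1) μ = 0 →
      (nlMultiplicity (polygonGraph G n) μ : ℤ) =
        (G.edgeFinset.card : ℤ) - (Fintype.card V : ℤ) + 1) ∧
    -- (vi)
    (∀ t : ℝ, IsNLEigenvalue G t → t ≠ 0 → t ≠ 2 →
      (polygonRoots m t).ncard = (n + 1) / 2 ∧
      ∀ μ ∈ polygonRoots m t,
        IsNLEigenvalue (polygonGraph G n) μ ∧
          nlMultiplicity (polygonGraph G n) μ = nlMultiplicity G t) ∧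
    -- every eigenvalue of the polygon graph is obtained in this way
    (∀ μ : ℝ, IsNLEigenvalue (polygonGraph G n) μ →
      μ = 0 ∨ (G.IsBipartite ∧ μ = 2) ∨ aSeq m μ = 0 ∨
      aSeq m μ + aSeq ((m : ℤ) - 1) μ = 0 ∨ aSeq m μ - aSeq ((m : ℤ) - 1) μ = 0 ∨
      ∃ t : ℝ, IsNLEigenvalue G t ∧ t ≠ 0 ∧ t ≠ 2 ∧ μ ∈ polygonRoots m t) := by
  have hm1 : 1 ≤ m := by omega
  subst hm
  have hd := nbrSum_one_pos hG
  have hE : G.edgeFinset.card = Fintype.card G.edgeSet := Set.toFinset_card _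
  simp only [aSeq_natCast, aSeq_natCast_sub_one, hE]
  have eig (μ : ℝ) {k : ℕ} (hk : k ≠ 0)
      (h : nlMultiplicity (polygonGraph G (2 * m + 1)) μ = k) :
      IsNLEigenvalue (polygonGraph G (2 * m + 1)) μ ∧
        nlMultiplicity (polygonGraph G (2 * m + 1)) μ = k :=
    ⟨(isNLEigenvalue_iff _ _).mpr (h ▸ hk), h⟩
  refine ⟨?_, ?_, ?_, ?_, ?_, ?_, ?_, ?_⟩
  · refine eig 0 one_ne_zero ?_
    rw [nlMultiplicity_polygonGraph_endpoint hm1 hd (by norm_num), nlMultiplicity_zero hG]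
  · intro hb
    refine eig 2 one_ne_zero ?_
    rw [nlMultiplicity_polygonGraph_endpoint hm1 hd (by norm_num), nlMultiplicity_two hG,
      finrank_edgeCompatible_neg_one hG hb]
  · intro μ hμ
    exact eig μ Fintype.card_ne_zero
      (nlMultiplicity_polygonGraph_of_aShift_eq_zero hm1 hd hμ)
  · intro μ hμ
    have h := nlMultiplicity_polygonGraph_add_card (σ := 1) hm1 hd (by norm_num)
      (show aShift μ (m + 1) = -1 * aShift μ m by linarith)
    rw [finrank_edgeCompatible_one hG] at h
    omega
  · intro hb μ hμ
    have h := nlMultiplicity_polygonGraph_add_card (σ := -1) hm1 hd (by norm_num)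
      (show aShift μ (m + 1) = - -1 * aShift μ m by linarith)
    rw [finrank_edgeCompatible_neg_one_of_not hG hb] at h
    omega
  · intro hb μ hμ
    have h := nlMultiplicity_polygonGraph_add_card (σ := -1) hm1 hd (by norm_num)
      (show aShift μ (m + 1) = - -1 * aShift μ m by linarith)
    rw [finrank_edgeCompatible_neg_one hG hb] at h
    omega
  · intro t ht h0 h2
    have habs := abs_one_sub_lt_one_of_isNLEigenvalue hd ht h0 h2
    refine ⟨by rw [ncard_polygonRoots hm1 habs]; omega, fun μ hμ => ?_⟩
    obtain ⟨hb, hs⟩ := aShift_ne_zero_of_mem_polygonRoots hm1 habs hμ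
    exact eig μ ((isNLEigenvalue_iff G t).mp ht) (nlMultiplicity_polygonGraph_eq hm1 hd hs hb hμ)
  · intro μ hμ
    by_cases hb : aShift μ (m + 1) = 0
    · exact Or.inr (Or.inr (Or.inl hb))
    by_cases h1 : aShift μ (m + 1) + aShift μ m = 0
    · exact Or.inr (Or.inr (Or.inr (Or.inl h1)))
    by_cases h2 : aShift μ (m + 1) - aShift μ m = 0
    · exact Or.inr (Or.inr (Or.inr (Or.inr (Or.inl h2))))
    rcases eq_of_isNLEigenvalue_polygonGraph hG hm1 hμ hb h1 h2 with h | h | h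
    · exact Or.inl h
    · exact Or.inr (Or.inl h)
    · exact Or.inr (Or.inr (Or.inr (Or.inr (Or.inr h))))
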